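/- Let $\mathcal H$ be a separable real Hilbert space, $\mathcal Y$ a real Banach space, $\mathcal K\subset\mathcal Y$ a nonempty closed convex cone with positive dual cone $\mathcal K^+=\{v^*\in\mathcal Y^*:\langle v^*,y\rangle\ge 0\ \forall y\in\mathcal K\}$, and $\mathcal C\subset\mathcal Y^*$ a nonempty weak$^*$-compact convex set with $\operatorname{cl}^{w^*}\operatorname{cone}\mathcal C=\mathcal K^+$. Let $\xi$ be an $m$-dimensional random vector on a probability space $(\Omega,\mathcal F,\mathbb P)$ having a density with respect to Lebesgue measure, let $\Phi:\mathcal H\times\mathbb R^m\to\mathcal Y$ be continuous, and let $h:\mathcal H\to\mathbb R$ be a continuously differentiable convex function such that for every $v^*\in\mathcal C$ the function $(x,z)\mapsto\langle v^*,\Phi(x,z)\rangle+h(x)$ is convex on $\mathcal H\times\mathbb R^m$. For $f:E\to\mathbb R\cup\{+\infty\}$ on a Hilbert space $E$ and $\lambda>0$ write $e_\lambda f(x)=\inf_{z\in E}\big(f(z)+\tfrac1{2\lambda}\|x-z\|^2\big)$ for the Moreau envelope. Put $S(x,z)=\sup_{v^*\in\mathcal C}\big(\langle v^*,\Phi(x,z)\rangle+h(x)\big)$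 on the Hilbert space $\mathcal H\times\mathbb R^m$, and $$\varphi(x)=\mathbb P\big(\Phi(x,\xi)\in-\mathcal K\big),\qquad \varphi_\lambda(x)=\mathbb P\big(e_\lambda S(x,\xi)\le h(x)\big).$$ Fix $p\in[0,1]$ and set $M(p)=\{x:\varphi(x)\ge p\}$, $M_\lambda(p)=\{x:\varphi_\lambda(x)\ge p\}$. Let $\psi:\mathcal H\to\mathbb R\cup\{+\infty\}$ be convex, lower semicontinuous and coercive (all sets $\{\psi\le\alpha\}$, $\alpha\in\mathbb R$, are bounded), with $M(p)\cap\operatorname{dom}\psi\neq\emptyset$. Let $(P)$ be the problem of minimizing $\psi$ over $M(p)$ and $(P_\lambda)$ that of minimizing $e_\lambda\psi$ over $M_\lambda(p)$, with values (infima) $v(P)$ and $v(P_\lambda)$. Then: a) $v(P)\in\mathbb R$ and $v(P_\lambda)\in\mathbb R$ for all $\lambda>0$; and, provided that $h$ is sequentially weakly continuous, $v(P_\lambda)\to v(P)$ as $\lambda\to0^+$. b) Suppose that $h$ is sequentially weakly continuous. Let $\lambda_k\to0^+$ and let $x_k$ be an optimal solution of $(P_{\lambda_k})$ for each $k$. If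 $x_k\rightharpoonup x_0$ weakly, then $x_0$ is an optimal solution of $(P)$. If, furthermore, $\operatorname{dom}\psi=\mathcal H$ and the conjugate $\psi^*(u)=\sup_y(\langle u,y\rangle-\psi(y))$ is Fréchet differentiable at every $u$ with $\partial\psi^*(u)\ne\emptyset$, then $x_k\to x_0$ in norm. -/

import Mathlib

open Set Filter Topology MeasureTheory
open scoped InnerProductSpace

noncomputable section

namespace ChanceConstraint

/-! ### Extended-real-valued convex analysis -/

section ConvexAnalysis

variable {E : Type*}

/-- The effective domain of an extended-real-valued function. -/
def effDom (f : E → EReal) : Set E := {x | f x < ⊤}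

/-- Convexity of an extended-real-valued function: its epigraph is a convex set. -/
def IsConvexFun [AddCommGroup E] [Module ℝ E] (f : E → EReal) : Prop :=
  Convex ℝ {q : E × ℝ | f q.1 ≤ (q.2 : EReal)}

/-- Coercivity: all (real) sublevel sets are bounded. -/
def IsCoercive [Bornology E] (f : E → EReal) : Prop :=
  ∀ α : ℝ, Bornology.IsBounded {x | f x ≤ (α : EReal)}

/-- The Moreau envelope of `f` of parameter `lam`. -/
def moreauEnv [NormedAddCommGroup E] (f : E → EReal) (lam : ℝ) (x : E) : EReal :=
  ⨅ z : E, f z + ((1 / (2 * lam) * ‖x - z‖ ^ 2 : ℝ) : EReal)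

variable [NormedAddCommGroup E] [InnerProductSpace ℝ E]

/-- The Legendre-Fenchel conjugate. -/
def conjugate (f : E → EReal) (z : E) : EReal :=
  ⨆ y : E, ((⟪z, y⟫_ℝ : ℝ) : EReal) - f y

/-- The convex subdifferential (empty where `f = +∞`). -/
def subdiff (f : E → EReal) (x : E) : Set E :=
  {z | f x < ⊤ ∧ ∀ y : E, f x + ((⟪z, y - x⟫_ℝ : ℝ) : EReal) ≤ f y}

/-- Fréchet differentiability of an extended-real-valued function at `x`: it is finite near `x`
and the resulting real-valued function is differentiable at `x`. -/
def FrechetDiffAt (f : E → EReal) (x : E) : Prop :=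
  (∀ᶠ y in 𝓝 x, f y ≠ ⊤ ∧ f y ≠ ⊥) ∧ DifferentiableAt ℝ (fun y => (f y).toReal) x

/-- Weak convergence of a sequence in a Hilbert space. -/
def WeaklyTendsto (u : ℕ → E) (x : E) : Prop :=
  ∀ y : E, Tendsto (fun k => ⟪y, u k⟫_ℝ) atTop (𝓝 ⟪y, x⟫_ℝ)

/-- Sequential weak continuity of a real function on a Hilbert space. -/
def SeqWeaklyContinuous (h : E → ℝ) : Prop :=
  ∀ (u : ℕ → E) (x : E), WeaklyTendsto u x → Tendsto (fun k => h (u k)) atTop (𝓝 (h x))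

end ConvexAnalysis

/-! ### Cones in the dual of a Banach space -/

section Cones

variable {Y : Type*} [NormedAddCommGroup Y] [NormedSpace ℝ Y]

/-- The positive dual cone of `K`, in the topological dual with its weak-* topology. -/
def posDual (K : Set Y) : Set (WeakDual ℝ Y) := {v | ∀ y ∈ K, 0 ≤ v y}

/-- The cone generated by a convex set `C`. -/
def genCone (C : Set (WeakDual ℝ Y)) : Set (WeakDual ℝ Y) :=
  {w | ∃ t : ℝ, 0 ≤ t ∧ ∃ v ∈ C, w = t • v}

end Cones

/-! ### The probability functions and the optimization problems -/

section Problem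

variable {H Y Ω : Type*} [NormedAddCommGroup H] [InnerProductSpace ℝ H]
  [NormedAddCommGroup Y] [NormedSpace ℝ Y] [MeasurableSpace Ω] {m : ℕ}

/-- The supremum function `S(x, z) = sup {⟨v, Φ(x, z)⟩ + h(x) : v ∈ C}` on the Hilbert space
`H × ℝᵐ` (the product with its Hilbert norm). -/
def supFun (Φ : H × EuclideanSpace ℝ (Fin m) → Y) (h : H → ℝ) (C : Set (WeakDual ℝ Y))
    (q : WithLp 2 (H × EuclideanSpace ℝ (Fin m))) : EReal :=
  ⨆ v ∈ C, ((v (Φ (q.fst, q.snd)) + h q.fst : ℝ) : EReal)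

/-- The probability function `φ(x) = ℙ(Φ(x, ξ) ∈ -K)`. -/
def probFun (P : Measure Ω) (ξ : Ω → EuclideanSpace ℝ (Fin m))
    (Φ : H × EuclideanSpace ℝ (Fin m) → Y) (K : Set Y) (x : H) : ℝ :=
  P.real {ω | -Φ (x, ξ ω) ∈ K}

/-- The inner regularization of the probability function: `S` is replaced by its Moreau envelope
in `φ(x) = ℙ(S(x, ξ) ≤ h(x))`. -/
def probFunReg (P : Measure Ω) (ξ : Ω → EuclideanSpace ℝ (Fin m))
    (Φ : H × EuclideanSpace ℝ (Fin m) → Y) (h : H → ℝ) (C : Set (WeakDual ℝ Y))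
    (lam : ℝ) (x : H) : ℝ :=
  P.real {ω | moreauEnv (supFun Φ h C) lam (WithLp.toLp 2 (x, ξ ω)) ≤ (h x : EReal)}

/-- The feasible set `M(p)`. -/
def feas (P : Measure Ω) (ξ : Ω → EuclideanSpace ℝ (Fin m))
    (Φ : H × EuclideanSpace ℝ (Fin m) → Y) (K : Set Y) (p : ℝ) : Set H :=
  {x | p ≤ probFun P ξ Φ K x}

/-- The regularized feasible set `M_λ(p)`. -/
def feasReg (P : Measure Ω) (ξ : Ω → EuclideanSpace ℝ (Fin m))
    (Φ : H × EuclideanSpace ℝ (Fin m) → Y) (h : H → ℝ) (C : Set (WeakDual ℝ Y))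
    (p lam : ℝ) : Set H :=
  {x | p ≤ probFunReg P ξ Φ h C lam x}

/-- The value of the problem of minimizing `f` over `M`. -/
def value (f : H → EReal) (M : Set H) : EReal := ⨅ x ∈ M, f x

/-- `x` is an optimal solution of the problem of minimizing `f` over `M`. -/
def IsOptimal (f : H → EReal) (M : Set H) (x : H) : Prop := x ∈ M ∧ IsMinOn f M x

end Problem

end ChanceConstraint

end

/-!
If `x k ⇀ x₀`, `lam k → 0⁺` and the envelopes `e_{lam k} f (x k)` stay below a convergent sequence,
then near-minimizers `w k` in the definition of the envelope satisfy `x k - w k → 0`, because an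
affine minorant of `f` makes the quadratic penalty dominate. Hence `w k ⇀ x₀`, and weak lower
semicontinuity of the convex function `f` bounds `f x₀` by the limit.

Applied to `f = S` for each fixed value of `ξ`, this shows that `Φ (x₀, ξ) ∈ -K` whenever `ξ` lies
in infinitely many of the events defining the regularized probabilities at `x k`; the reverse Fatou
lemma then gives `x₀ ∈ M(p)`. Since also `M(p) ⊆ M_lam(p)`, the regularized feasible sets are outer
approximations of `M(p)`. Applied to `f = ψ`, with coercivity supplying the weakly convergent
subsequences, it gives the convergence of the values and the optimality of weak limits of solutions.

For norm convergence, take a subgradient `u` of `ψ` at `x₀`, so that `x₀` minimizes `ψ - ⟨u, ·⟩` and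
belongs to the subdifferential of `ψ*` at `u`. The near-minimizers `w k` form a minimizing sequence
for `ψ - ⟨u, ·⟩`, and the Šmulian argument turns Fréchet differentiability of `ψ*` at `u` into norm
convergence of minimizing sequences to the gradient of `ψ*` at `u`, which is `x₀`.
-/

namespace ChanceConstraint

section WeakConvergence

variable {E : Type*} [NormedAddCommGroup E] [InnerProductSpace ℝ E]

theorem weaklyTendsto_of_tendsto {u : ℕ → E} {x : E} (h : Tendsto u atTop (𝓝 x)) :
    WeaklyTendsto u x :=
  fun _ => tendsto_const_nhds.inner h

theorem WeaklyTendsto.comp_tendsto {u : ℕ → E} {x : E} (h : WeaklyTendsto u x) {φ : ℕ → ℕ}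
    (hφ : Tendsto φ atTop atTop) : WeaklyTendsto (u ∘ φ) x :=
  fun y => (h y).comp hφ

theorem WeaklyTendsto.of_tendsto_sub_zero {u w : ℕ → E} {x : E} (h : WeaklyTendsto u x)
    (huw : Tendsto (u - w) atTop (𝓝 0)) : WeaklyTendsto w x := by
  intro y
  simpa [inner_sub_right] using (h y).sub (weaklyTendsto_of_tendsto huw y)

theorem WeaklyTendsto.toLp {u : ℕ → E} {x : E} (h : WeaklyTendsto u x) {G : Type*}
    [NormedAddCommGroup G] [InnerProductSpace ℝ G] (z : G) :
    WeaklyTendsto (fun k => WithLp.toLp 2 (u k, z)) (WithLp.toLp 2 (x, z)) := by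
  intro y
  simp only [WithLp.prod_inner_apply]
  exact (h y.fst).add tendsto_const_nhds

theorem SeqWeaklyContinuous.continuous {h : E → ℝ} (hh : SeqWeaklyContinuous h) : Continuous h :=
  continuous_iff_seqContinuous.2 fun u x hu => hh u x (weaklyTendsto_of_tendsto hu)

theorem WeaklyTendsto.exists_norm_le [CompleteSpace E] {u : ℕ → E} {x : E}
    (h : WeaklyTendsto u x) : ∃ R, ∀ k, ‖u k‖ ≤ R := by
  obtain ⟨R, hR⟩ := banach_steinhaus (g := fun k => innerSL ℝ (u k)) fun y => by
    obtain ⟨c, hc⟩ := (h y).norm.bddAbove_range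
    exact ⟨c, fun k => by simpa [real_inner_comm] using hc ⟨k, rfl⟩⟩
  exact ⟨R, fun k => by simpa using hR k⟩

theorem WeaklyTendsto.mem_of_isClosed_of_convex [CompleteSpace E] {u : ℕ → E} {x : E}
    (h : WeaklyTendsto u x) {s : Set E} (hs : IsClosed s) (hc : Convex ℝ s)
    (hu : ∀ᶠ k in atTop, u k ∈ s) : x ∈ s := by
  by_contra hx
  obtain ⟨g, c, hg, hcx⟩ := geometric_hahn_banach_closed_point hc hs hx
  have hlim := h ((InnerProductSpace.toDual ℝ E).symm g)
  simp only [InnerProductSpace.toDual_symm_apply] at hlim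
  exact hcx.not_ge (le_of_tendsto hlim (hu.mono fun k hk => (hg _ hk).le))

theorem exists_subseq_weaklyTendsto_of_separableSpace [CompleteSpace E]
    [TopologicalSpace.SeparableSpace E] {u : ℕ → E} {R : ℝ} (hu : ∀ k, ‖u k‖ ≤ R) :
    ∃ (x : E) (φ : ℕ → ℕ), StrictMono φ ∧ WeaklyTendsto (u ∘ φ) x := by
  obtain ⟨a, -, φ, hφ, ha⟩ := WeakDual.isSeqCompact_closedBall ℝ E (0 : StrongDual ℝ E) R
    (x := fun k => StrongDual.toWeakDual (InnerProductSpace.toDual ℝ E (u k)))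
    (fun k => by simpa using hu k)
  refine ⟨(InnerProductSpace.toDual ℝ E).symm (WeakDual.toStrongDual a), φ, hφ, fun y => ?_⟩
  rw [real_inner_comm, InnerProductSpace.toDual_symm_apply]
  refine ((WeakDual.eval_continuous y).continuousAt.tendsto.comp ha).congr fun k => ?_
  exact real_inner_comm y (u (φ k))

theorem exists_subseq_weaklyTendsto [CompleteSpace E] {u : ℕ → E} {R : ℝ}
    (hu : ∀ k, ‖u k‖ ≤ R) :
    ∃ (x : E) (φ : ℕ → ℕ), StrictMono φ ∧ WeaklyTendsto (u ∘ φ) x := by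
  set F : Submodule ℝ E := (Submodule.span ℝ (range u)).topologicalClosure
  have huF : ∀ k, u k ∈ F := fun k =>
    Submodule.le_topologicalClosure _ (Submodule.subset_span (mem_range_self k))
  have : CompleteSpace F := (Submodule.isClosed_topologicalClosure _).completeSpace_coe
  have : TopologicalSpace.SeparableSpace F :=
    ((countable_range u).isSeparable.span (R := ℝ)).closure.separableSpace
  obtain ⟨x, φ, hφ, hx⟩ :=
    exists_subseq_weaklyTendsto_of_separableSpace (u := fun k => (⟨u k, huF k⟩ : F)) hu
  refine ⟨x, φ, hφ, fun y => ?_⟩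
  have hproj : ∀ z : F, ⟪y, z⟫_ℝ = ⟪F.orthogonalProjectionOnto y, z⟫_ℝ := fun z => by
    rw [Submodule.inner_orthogonalProjectionOnto_eq_of_mem_right]
  rw [hproj]
  exact (hx (F.orthogonalProjectionOnto y)).congr fun k => (hproj ⟨u (φ k), huF (φ k)⟩).symm

end WeakConvergence

section AffineMinorants

theorem isClosed_real_epigraph {E : Type*} [TopologicalSpace E] {f : E → EReal}
    (hlsc : LowerSemicontinuous f) : IsClosed {q : E × ℝ | f q.1 ≤ (q.2 : EReal)} :=
  hlsc.isClosed_epigraph.preimage (continuous_id.prodMap continuous_coe_real_ereal)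

variable {E : Type*} [NormedAddCommGroup E] [NormedSpace ℝ E]

/-- `f` has a continuous affine minorant. This one-sided bound is all that is needed to control
near-minimizers in the definition of the Moreau envelope of `f`. -/
def HasAffineMinorant (f : E → EReal) : Prop :=
  ∃ (g : StrongDual ℝ E) (a : ℝ), ∀ x, ((g x + a : ℝ) : EReal) ≤ f x

theorem strongDual_prod_apply (F : StrongDual ℝ (E × ℝ)) (x : E) (t : ℝ) :
    F (x, t) = F (x, 0) + t * F (0, 1) := by
  rw [← smul_eq_mul, ← map_smul, ← map_add]
  simp

theorem IsConvexFun.hasAffineMinorant {f : E → EReal} (hf : IsConvexFun f)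
    (hlsc : LowerSemicontinuous f) (hbot : ∀ x, f x ≠ ⊥) : HasAffineMinorant f := by
  by_cases hdom : ∃ x₀, f x₀ ≠ ⊤
  swap
  · push Not at hdom
    exact ⟨0, 0, fun x => by simp [hdom x]⟩
  obtain ⟨x₀, hx₀⟩ := hdom
  lift f x₀ to ℝ using ⟨hx₀, hbot x₀⟩ with c hc
  obtain ⟨F, b, hFb, hbF⟩ := geometric_hahn_banach_point_closed (x := (x₀, c - 1)) hf
    (isClosed_real_epigraph hlsc) (by simp [← hc, -EReal.coe_sub])
  set γ := F (0, 1)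
  have hγ : 0 < γ := by
    have hF := hFb.trans (hbF (x₀, c) hc.ge)
    rw [strongDual_prod_apply, strongDual_prod_apply F x₀ c] at hF
    linarith
  refine ⟨-(γ⁻¹ • F.comp (.inl ℝ E ℝ)), γ⁻¹ * b, fun x => ?_⟩
  refine EReal.le_of_forall_lt_iff_le.1 fun t ht => ?_
  have hF := (hbF (x, t) ht.le).le
  rw [strongDual_prod_apply] at hF
  have hmul := mul_le_mul_of_nonneg_left hF (inv_pos.2 hγ).le
  rw [mul_add, mul_comm t, inv_mul_cancel_left₀ hγ.ne'] at hmul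
  refine EReal.coe_le_coe_iff.2 ?_
  change -(γ⁻¹ * F (x, 0)) + γ⁻¹ * b ≤ t
  linarith

theorem HasAffineMinorant.exists_forall_le {f : E → EReal} (hf : HasAffineMinorant f)
    (hcoer : IsCoercive f) : ∃ c : ℝ, ∀ x, (c : EReal) ≤ f x := by
  obtain ⟨g, a, hga⟩ := hf
  obtain ⟨R, hR⟩ := (hcoer 0).exists_norm_le
  refine ⟨min 0 (a - ‖g‖ * R), fun x => ?_⟩
  rcases le_total (f x) ((0 : ℝ) : EReal) with hx | hx
  · refine le_trans (EReal.coe_le_coe_iff.2 ((min_le_right _ _).trans ?_)) (hga x)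
    have := neg_le_of_abs_le (g.le_of_opNorm_le_of_le le_rfl (hR x hx))
    linarith
  · exact (EReal.coe_le_coe_iff.2 (min_le_left _ _)).trans hx

end AffineMinorants

section MoreauEnvelope

variable {E : Type*} [NormedAddCommGroup E]

theorem moreauEnv_le (f : E → EReal) (lam : ℝ) (x : E) : moreauEnv f lam x ≤ f x :=
  (iInf_le _ x).trans (by simp)

theorem le_moreauEnv {f : E → EReal} {c : EReal} (hf : ∀ x, c ≤ f x) {lam : ℝ} (hlam : 0 < lam)
    (x : E) : c ≤ moreauEnv f lam x :=
  le_iInf fun z => (hf z).trans <| le_add_of_nonneg_right <| by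
    exact_mod_cast (by positivity : (0 : ℝ) ≤ 1 / (2 * lam) * ‖x - z‖ ^ 2)

theorem upperSemicontinuous_moreauEnv (f : E → EReal) (lam : ℝ) :
    UpperSemicontinuous (moreauEnv f lam) := by
  refine upperSemicontinuous_iInf fun z => Continuous.upperSemicontinuous ?_
  induction f z with
  | bot => simpa only [EReal.bot_add] using continuous_const
  | top => simpa only [EReal.top_add_coe] using continuous_const
  | coe c =>
    simp_rw [← EReal.coe_add]
    exact continuous_coe_real_ereal.comp (by fun_prop)

theorem exists_add_lt_of_moreauEnv_lt {f : E → EReal} (hbot : ∀ x, f x ≠ ⊥) {lam c : ℝ} {x : E}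
    (h : moreauEnv f lam x < c) :
    ∃ (z : E) (r : ℝ), f z = r ∧ r + 1 / (2 * lam) * ‖x - z‖ ^ 2 < c := by
  obtain ⟨z, hz⟩ := iInf_lt_iff.1 h
  have htop : f z ≠ ⊤ := by
    intro htop
    rw [htop, EReal.top_add_coe] at hz
    exact not_top_lt hz
  lift f z to ℝ using ⟨htop, hbot z⟩ with r hr
  exact ⟨z, r, hr.symm, by exact_mod_cast hz⟩

theorem tendsto_zero_of_sq_div_le {t lam : ℕ → ℝ} {A B : ℝ} (ht : ∀ k, 0 ≤ t k)
    (hlam : ∀ k, 0 < lam k) (hlim : Tendsto lam atTop (𝓝 0))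
    (h : ∀ k, 1 / (2 * lam k) * t k ^ 2 ≤ A + B * t k) : Tendsto t atTop (𝓝 0) := by
  have hbound : ∀ k, t k ^ 2 ≤ 4 * lam k * A + 4 * lam k ^ 2 * B ^ 2 := fun k => by
    have hsq : t k ^ 2 ≤ 2 * lam k * (A + B * t k) := by
      have := h k
      rwa [one_div_mul_eq_div, div_le_iff₀' (mul_pos two_pos (hlam k))] at this
    -- AM-GM: `2 * (2 * lam * B) * t ≤ t ^ 2 + (2 * lam * B) ^ 2`
    nlinarith [sq_nonneg (t k - 2 * lam k * B)]
  have hbound_lim : Tendsto (fun k => 4 * lam k * A + 4 * lam k ^ 2 * B ^ 2) atTop (𝓝 0) := by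
    simpa using ((hlim.const_mul 4).mul_const A).add (((hlim.pow 2).const_mul 4).mul_const (B ^ 2))
  have hsqrt := (squeeze_zero (fun k => sq_nonneg (t k)) hbound hbound_lim).sqrt
  simpa [Real.sqrt_sq (ht _)] using hsqrt

theorem exists_seq_le_of_moreauEnv_le {f : E → EReal} {lam c : ℕ → ℝ} {x : ℕ → E} {a b c₀ : ℝ}
    (hf : ∀ k z, ((a - b * ‖x k - z‖ : ℝ) : EReal) ≤ f z) (hlam : ∀ k, 0 < lam k)
    (hlim : Tendsto lam atTop (𝓝 0)) (hc : Tendsto c atTop (𝓝 c₀))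
    (h : ∀ k, moreauEnv f (lam k) (x k) ≤ c k) :
    ∃ (w : ℕ → E) (d : ℕ → ℝ), (∀ k, f (w k) ≤ d k) ∧ Tendsto d atTop (𝓝 c₀) ∧
      Tendsto (x - w) atTop (𝓝 0) := by
  obtain ⟨d, hcd, hdlim⟩ : ∃ d : ℕ → ℝ, (∀ k, c k < d k) ∧ Tendsto d atTop (𝓝 c₀) := by
    refine ⟨fun k => c k + 1 / ((k : ℝ) + 1), fun k => lt_add_of_pos_right _ (by positivity), ?_⟩
    simpa using hc.add tendsto_one_div_add_atTop_nhds_zero_nat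
  have hbot : ∀ z, f z ≠ ⊥ := fun z => ne_bot_of_le_ne_bot (EReal.coe_ne_bot _) (hf 0 z)
  choose w r hr hw using fun k =>
    exists_add_lt_of_moreauEnv_lt hbot ((h k).trans_lt (EReal.coe_lt_coe_iff.2 (hcd k)))
  refine ⟨w, d, fun k => ?_, hdlim, ?_⟩
  · have hpen : 0 ≤ 1 / (2 * lam k) * ‖x k - w k‖ ^ 2 := by
      have := hlam k
      positivity
    rw [hr, EReal.coe_le_coe_iff]
    linarith [hw k]
  · obtain ⟨D, hD⟩ := hdlim.bddAbove_range
    refine tendsto_zero_iff_norm_tendsto_zero.2 <| tendsto_zero_of_sq_div_le (A := D - a) (B := b)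
      (fun k => norm_nonneg _) hlam hlim fun k => ?_
    have hfw := hf k (w k)
    rw [hr, EReal.coe_le_coe_iff] at hfw
    have hdD : d k ≤ D := hD ⟨k, rfl⟩
    rw [Pi.sub_apply]
    linarith [hw k]

theorem HasAffineMinorant.exists_seq_le_of_moreauEnv_le [NormedSpace ℝ E] {f : E → EReal}
    (hf : HasAffineMinorant f) {lam c : ℕ → ℝ} {x : ℕ → E} {R c₀ : ℝ} (hx : ∀ k, ‖x k‖ ≤ R)
    (hlam : ∀ k, 0 < lam k) (hlim : Tendsto lam atTop (𝓝 0)) (hc : Tendsto c atTop (𝓝 c₀))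
    (h : ∀ k, moreauEnv f (lam k) (x k) ≤ c k) :
    ∃ (w : ℕ → E) (d : ℕ → ℝ), (∀ k, f (w k) ≤ d k) ∧ Tendsto d atTop (𝓝 c₀) ∧
      Tendsto (x - w) atTop (𝓝 0) := by
  obtain ⟨g, a, hga⟩ := hf
  refine ChanceConstraint.exists_seq_le_of_moreauEnv_le (a := a - ‖g‖ * R) (b := ‖g‖)
    (fun k z => le_trans (EReal.coe_le_coe_iff.2 ?_) (hga z)) hlam hlim hc h
  have hgx := neg_le_of_abs_le (g.le_of_opNorm_le_of_le le_rfl (hx k))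
  have hgxz := le_of_abs_le (g.le_opNorm (x k - z))
  rw [map_sub] at hgxz
  linarith

theorem IsCoercive.exists_norm_le_of_moreauEnv_le {f : E → EReal} (hcoer : IsCoercive f) {a : ℝ}
    (hf : ∀ z, (a : EReal) ≤ f z) {lam : ℕ → ℝ} {x : ℕ → E} {c : ℝ} (hlam : ∀ k, 0 < lam k)
    (hlim : Tendsto lam atTop (𝓝 0)) (h : ∀ k, moreauEnv f (lam k) (x k) ≤ c) :
    ∃ R, ∀ k, ‖x k‖ ≤ R := by
  obtain ⟨w, d, hwd, hd, hxw⟩ := exists_seq_le_of_moreauEnv_le (a := a) (b := 0)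
    (fun k z => by simpa using hf z) hlam hlim tendsto_const_nhds h
  obtain ⟨D, hD⟩ := hd.bddAbove_range
  obtain ⟨R, hR⟩ := (hcoer D).exists_norm_le
  obtain ⟨S, hS⟩ := hxw.norm.bddAbove_range
  have hw : ∀ k, ‖w k‖ ≤ R := fun k =>
    hR _ ((hwd k).trans (EReal.coe_le_coe_iff.2 (hD (mem_range_self k))))
  exact ⟨S + R, fun k => (norm_le_norm_sub_add (x k) (w k)).trans
    (add_le_add (hS (mem_range_self k)) (hw k))⟩

end MoreauEnvelope

section WeakLowerSemicontinuity

variable {E : Type*}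

theorem IsConvexFun.convex_sublevel [AddCommGroup E] [Module ℝ E] {f : E → EReal}
    (hf : IsConvexFun f) (α : ℝ) : Convex ℝ {x | f x ≤ (α : EReal)} := by
  intro x hx y hy a b ha hb hab
  have hmem := hf (x := (x, α)) hx (y := (y, α)) hy ha hb hab
  simpa [← add_mul, hab] using hmem

variable [NormedAddCommGroup E] [InnerProductSpace ℝ E] [CompleteSpace E]

theorem IsConvexFun.le_of_weaklyTendsto {f : E → EReal} (hf : IsConvexFun f)
    (hlsc : LowerSemicontinuous f) {x : ℕ → E} {x₀ : E} (hx : WeaklyTendsto x x₀) {c : ℕ → ℝ}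
    {c₀ : ℝ} (hc : Tendsto c atTop (𝓝 c₀)) (h : ∀ k, f (x k) ≤ c k) : f x₀ ≤ c₀ := by
  refine EReal.le_of_forall_lt_iff_le.1 fun d hd => ?_
  refine hx.mem_of_isClosed_of_convex (s := {y | f y ≤ (d : EReal)})
    (hlsc.isClosed_preimage _) (hf.convex_sublevel d) ?_
  filter_upwards [hc.eventually_lt_const (EReal.coe_lt_coe_iff.1 hd)] with k hk
  exact (h k).trans (EReal.coe_le_coe_iff.2 hk.le)

theorem IsConvexFun.le_of_weaklyTendsto_of_moreauEnv_le {f : E → EReal} (hf : IsConvexFun f)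
    (hlsc : LowerSemicontinuous f) (hbot : ∀ x, f x ≠ ⊥) {lam c : ℕ → ℝ} {x : ℕ → E} {x₀ : E}
    {c₀ : ℝ} (hlam : ∀ k, 0 < lam k) (hlim : Tendsto lam atTop (𝓝 0)) (hx : WeaklyTendsto x x₀)
    (hc : Tendsto c atTop (𝓝 c₀)) (h : ∀ k, moreauEnv f (lam k) (x k) ≤ c k) : f x₀ ≤ c₀ := by
  obtain ⟨R, hR⟩ := hx.exists_norm_le
  obtain ⟨w, d, hwd, hd, hxw⟩ :=
    (hf.hasAffineMinorant hlsc hbot).exists_seq_le_of_moreauEnv_le hR hlam hlim hc h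
  exact hf.le_of_weaklyTendsto hlsc (hx.of_tendsto_sub_zero hxw) hd hwd

end WeakLowerSemicontinuity

section Conjugate

variable {E : Type*} [NormedAddCommGroup E] [InnerProductSpace ℝ E]

theorem inner_sub_le_conjugate (f : E → EReal) (u y : E) :
    ((⟪u, y⟫_ℝ : ℝ) : EReal) - f y ≤ conjugate f u :=
  le_iSup (fun y => ((⟪u, y⟫_ℝ : ℝ) : EReal) - f y) y

theorem inner_sub_le_toReal_conjugate {f : E → EReal} {u y : E} {c : ℝ}
    (htop : conjugate f u ≠ ⊤) (hbot : conjugate f u ≠ ⊥) (hy : f y ≤ c) :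
    ⟪u, y⟫_ℝ - c ≤ (conjugate f u).toReal := by
  rw [← EReal.coe_le_coe_iff, EReal.coe_toReal htop hbot, EReal.coe_sub]
  exact (EReal.sub_le_sub le_rfl hy).trans (inner_sub_le_conjugate f u y)

theorem hasAffineMinorant_of_mem_subdiff {f : E → EReal} {x u : E} {r : ℝ} (hx : f x = r)
    (hu : u ∈ subdiff f x) : HasAffineMinorant f := by
  refine ⟨innerSL ℝ u, r - ⟪u, x⟫_ℝ, fun y => le_trans (le_of_eq ?_) (hu.2 y)⟩
  rw [hx, ← EReal.coe_add, inner_sub_right, innerSL_apply_apply]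
  congr 1
  ring

theorem conjugate_eq_of_mem_subdiff {f : E → EReal} {x u : E} {r : ℝ} (hx : f x = r)
    (hu : u ∈ subdiff f x) : conjugate f u = ((⟪u, x⟫_ℝ - r : ℝ) : EReal) := by
  refine le_antisymm (iSup_le fun y => ?_) ?_
  · have hy := hu.2 y
    rw [hx, ← EReal.coe_add, inner_sub_right] at hy
    refine (EReal.sub_le_sub le_rfl hy).trans (le_of_eq ?_)
    rw [← EReal.coe_sub]
    congr 1
    ring
  · rw [EReal.coe_sub, ← hx]
    exact inner_sub_le_conjugate f u x

theorem mem_subdiff_conjugate {f : E → EReal} {x u : E} {r : ℝ} (hx : f x = r)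
    (hu : u ∈ subdiff f x) : x ∈ subdiff (conjugate f) u := by
  rw [subdiff, mem_ofPred_eq, conjugate_eq_of_mem_subdiff hx hu]
  refine ⟨EReal.coe_lt_top _, fun v => le_trans (le_of_eq ?_) (inner_sub_le_conjugate f v x)⟩
  rw [hx, ← EReal.coe_add, ← EReal.coe_sub, inner_sub_right, real_inner_comm x u,
    real_inner_comm x v]
  congr 1
  ring

end Conjugate

section Subdifferentiability

theorem continuous_of_convexOn_of_lowerSemicontinuous {E : Type*} [NormedAddCommGroup E]
    [NormedSpace ℝ E] [CompleteSpace E] {g : E → ℝ} (hg : ConvexOn ℝ univ g)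
    (hlsc : LowerSemicontinuous g) : Continuous g := by
  obtain ⟨n, y, hy⟩ : ∃ n : ℕ, (interior (g ⁻¹' Iic (n : ℝ))).Nonempty := by
    refine nonempty_interior_of_iUnion_of_closed (fun n => hlsc.isClosed_preimage _) ?_
    exact iUnion_eq_univ_iff.2 fun x => exists_nat_ge (g x)
  have hbdd : ∃ y ∈ univ, (𝓝 y).IsBoundedUnder (· ≤ ·) g :=
    ⟨y, mem_univ y, n, eventually_map.2 (mem_interior_iff_mem_nhds.1 hy)⟩
  exact continuousOn_univ.1 <|
    ((hg.continuousOn_tfae isOpen_univ univ_nonempty).out 3 1).1 hbdd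

theorem exists_subgradient_of_convexOn_of_continuous {E : Type*} [NormedAddCommGroup E]
    [NormedSpace ℝ E] {g : E → ℝ} (hg : ConvexOn ℝ univ g) (hcont : Continuous g) (x₀ : E) :
    ∃ u : StrongDual ℝ E, ∀ y, g x₀ + u (y - x₀) ≤ g y := by
  have hopen : IsOpen {q : E × ℝ | q.1 ∈ univ ∧ g q.1 < q.2} := by
    simpa using isOpen_lt (hcont.comp continuous_fst) continuous_snd
  obtain ⟨F, hF⟩ := geometric_hahn_banach_open_point (x := (x₀, g x₀)) hg.convex_strict_epigraph
    hopen (by simp)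
  replace hF : ∀ y t, g y < t → F (y - x₀, 0) < -F (0, 1) * (t - g x₀) := fun y t ht => by
    have hlt := hF (y, t) ⟨mem_univ y, ht⟩
    rw [strongDual_prod_apply, strongDual_prod_apply F x₀] at hlt
    have hsub : F (y - x₀, 0) = F (y, 0) - F (x₀, 0) := by rw [← map_sub]; simp
    linarith
  have hγ : 0 < -F (0, 1) := by
    simpa [← Prod.zero_eq_mk] using hF x₀ (g x₀ + 1) (lt_add_one _)
  refine ⟨(-F (0, 1))⁻¹ • F.comp (.inl ℝ E ℝ), fun y => le_of_forall_gt_imp_ge_of_dense ?_⟩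
  intro t ht
  have hle : (-F (0, 1))⁻¹ * F (y - x₀, 0) ≤ t - g x₀ :=
    (inv_mul_le_iff₀ hγ).2 (hF y t ht).le
  change g x₀ + (-F (0, 1))⁻¹ * F (y - x₀, 0) ≤ t
  linarith

variable {E : Type*}

theorem IsConvexFun.convexOn_of_forall_eq_coe [AddCommGroup E] [Module ℝ E] {f : E → EReal}
    (hf : IsConvexFun f) {g : E → ℝ} (hfg : ∀ x, f x = g x) : ConvexOn ℝ univ g := by
  rw [convexOn_iff_convex_epigraph]
  simpa [IsConvexFun, hfg] using hf

theorem lowerSemicontinuous_of_forall_eq_coe [TopologicalSpace E] {f : E → EReal}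
    (hf : LowerSemicontinuous f) {g : E → ℝ} (hfg : ∀ x, f x = g x) : LowerSemicontinuous g :=
  lowerSemicontinuous_iff_isClosed_preimage.2 fun t => by
    have hpre : g ⁻¹' Iic t = f ⁻¹' Iic (t : EReal) := by ext; simp [hfg]
    exact hpre ▸ hf.isClosed_preimage _

theorem IsConvexFun.subdiff_nonempty [NormedAddCommGroup E] [InnerProductSpace ℝ E]
    [CompleteSpace E] {f : E → EReal} (hf : IsConvexFun f) (hlsc : LowerSemicontinuous f)
    (hbot : ∀ x, f x ≠ ⊥) (hdom : effDom f = univ) (x : E) : (subdiff f x).Nonempty := by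
  have hfg : ∀ y, f y = (f y).toReal := fun y =>
    (EReal.coe_toReal (hdom.ge (mem_univ y) : f y < ⊤).ne (hbot y)).symm
  have hg := hf.convexOn_of_forall_eq_coe hfg
  have hcont := continuous_of_convexOn_of_lowerSemicontinuous hg
    (lowerSemicontinuous_of_forall_eq_coe hlsc hfg)
  obtain ⟨u, hu⟩ := exists_subgradient_of_convexOn_of_continuous hg hcont x
  refine ⟨(InnerProductSpace.toDual ℝ E).symm u, hdom.ge (mem_univ x), fun y => ?_⟩
  rw [hfg x, hfg y, InnerProductSpace.toDual_symm_apply, ← EReal.coe_add]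
  exact EReal.coe_le_coe_iff.2 (hu y)

end Subdifferentiability

section StrongConvergence

variable {E : Type*} [NormedAddCommGroup E] [InnerProductSpace ℝ E]

theorem norm_le_div_of_forall_inner_le {z : E} {δ c : ℝ} (hδ : 0 < δ)
    (h : ∀ v : E, ‖v‖ ≤ δ → ⟪v, z⟫_ℝ ≤ c) : ‖z‖ ≤ c / δ := by
  rcases eq_or_ne z 0 with rfl | hz
  · simpa using div_nonneg (by simpa using h 0 (by simpa using hδ.le)) hδ.le
  have hz_pos : 0 < ‖z‖ := norm_pos_iff.2 hz
  have hv := h ((δ / ‖z‖) • z) (by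
    rw [norm_smul, Real.norm_of_nonneg (by positivity), div_mul_cancel₀ _ hz_pos.ne'])
  rw [real_inner_smul_left, real_inner_self_eq_norm_mul_norm, ← mul_assoc,
    div_mul_cancel₀ _ hz_pos.ne'] at hv
  rwa [le_div_iff₀' hδ]

variable [CompleteSpace E]

theorem FrechetDiffAt.tendsto_gradient_conjugate {f : E → EReal} {u : E}
    (hdiff : FrechetDiffAt (conjugate f) u) {y : ℕ → E} {ε : ℕ → ℝ} (hε : Tendsto ε atTop (𝓝 0))
    (hy : ∀ k, f (y k) ≤ ((⟪u, y k⟫_ℝ - (conjugate f u).toReal + ε k : ℝ) : EReal)) :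
    Tendsto y atTop (𝓝 (gradient (fun v => (conjugate f v).toReal) u)) := by
  obtain ⟨hfin, hd⟩ := hdiff
  set G : E → ℝ := fun v => (conjugate f v).toReal
  set D : E := gradient G u
  refine Metric.tendsto_atTop.2 fun η hη => ?_
  have hsmall := (hasGradientAt_iff_isLittleO.1 hd.hasGradientAt).def
    (c := η / 2) (by positivity)
  obtain ⟨δ, hδ, hball⟩ := Metric.nhds_basis_closedBall.eventually_iff.1 (hsmall.and hfin)
  obtain ⟨N, hN⟩ := eventually_atTop.1 (hε.eventually_lt_const (show 0 < δ * (η / 2) by positivity))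
  refine ⟨N, fun k hk => ?_⟩
  have hinner : ∀ v : E, ‖v‖ ≤ δ → ⟪v, y k - D⟫_ℝ ≤ δ * (η / 2) + ε k := fun v hv => by
    obtain ⟨hexp, htop, hbot⟩ := hball (x := u + v) (by simpa using hv)
    have hyoung := inner_sub_le_toReal_conjugate htop hbot (hy k)
    have hexp_le : G (u + v) - G u - ⟪D, v⟫_ℝ ≤ η / 2 * ‖v‖ := by
      simpa only [add_sub_cancel_left] using (le_abs_self _).trans hexp
    have hηv : η / 2 * ‖v‖ ≤ δ * (η / 2) := by
      rw [mul_comm δ]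
      gcongr
    rw [inner_add_left] at hyoung
    rw [inner_sub_right, real_inner_comm D v]
    linarith
  calc dist (y k) D ≤ (δ * (η / 2) + ε k) / δ := by
        rw [dist_eq_norm]
        exact norm_le_div_of_forall_inner_le hδ hinner
    _ < η := by
        rw [div_lt_iff₀ hδ]
        linarith [hN k hk]

theorem tendsto_of_weaklyTendsto_of_frechetDiffAt_conjugate {f : E → EReal} {x₀ u : E} {r : ℝ}
    (hr : f x₀ = r) (hu : u ∈ subdiff f x₀) (hdiff : FrechetDiffAt (conjugate f) u) {w : ℕ → E}
    {d : ℕ → ℝ} (hw : WeaklyTendsto w x₀) (hd : ∀ k, f (w k) ≤ d k)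
    (hdlim : Tendsto d atTop (𝓝 r)) : Tendsto w atTop (𝓝 x₀) := by
  have hconj : (conjugate f u).toReal = ⟪u, x₀⟫_ℝ - r := by
    rw [conjugate_eq_of_mem_subdiff hr hu, EReal.toReal_coe]
  have hgrad : gradient (fun v => (conjugate f v).toReal) u = x₀ :=
    tendsto_nhds_unique
      (hdiff.tendsto_gradient_conjugate (y := fun _ => x₀) (ε := fun _ => 0) tendsto_const_nhds
        fun _ => by simp [hr, hconj])
      tendsto_const_nhds
  rw [← hgrad]
  refine hdiff.tendsto_gradient_conjugate
    (ε := fun k => (d k - r) - (⟪u, w k⟫_ℝ - ⟪u, x₀⟫_ℝ)) ?_ fun k => (hd k).trans (le_of_eq ?_)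
  · simpa using (hdlim.sub_const r).sub ((hw u).sub_const ⟪u, x₀⟫_ℝ)
  · rw [hconj]
    congr 1
    ring

theorem tendsto_of_weaklyTendsto_of_moreauEnv_le {f : E → EReal} {x₀ u : E} {r : ℝ}
    (hr : f x₀ = r) (hu : u ∈ subdiff f x₀) (hdiff : FrechetDiffAt (conjugate f) u)
    {lam : ℕ → ℝ} {x : ℕ → E} (hlam : ∀ k, 0 < lam k) (hlim : Tendsto lam atTop (𝓝 0))
    (hx : WeaklyTendsto x x₀) (h : ∀ k, moreauEnv f (lam k) (x k) ≤ f x₀) :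
    Tendsto x atTop (𝓝 x₀) := by
  obtain ⟨R, hR⟩ := hx.exists_norm_le
  obtain ⟨w, d, hwd, hd, hxw⟩ := (hasAffineMinorant_of_mem_subdiff hr hu)
    |>.exists_seq_le_of_moreauEnv_le hR hlam hlim tendsto_const_nhds (hr ▸ h)
  have hw := tendsto_of_weaklyTendsto_of_frechetDiffAt_conjugate hr hu hdiff
    (hx.of_tendsto_sub_zero hxw) hwd hd
  simpa using hw.add hxw

end StrongConvergence

section Optimization

theorem exists_value_eq_coe {E : Type*} {f : E → EReal} {M : Set E} {c : ℝ}
    (hc : ∀ x, (c : EReal) ≤ f x) (hM : (M ∩ effDom f).Nonempty) :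
    ∃ r : ℝ, value f M = (r : EReal) := by
  obtain ⟨x, hxM, hx⟩ := hM
  have htop : value f M < ⊤ := (iInf₂_le x hxM).trans_lt hx
  have hbot : value f M ≠ ⊥ :=
    ne_bot_of_le_ne_bot (EReal.coe_ne_bot c) (le_iInf₂ fun y _ => hc y)
  exact ⟨_, (EReal.coe_toReal htop.ne hbot).symm⟩

theorem value_moreauEnv_le {E : Type*} [NormedAddCommGroup E] {M N : Set E} (hMN : M ⊆ N)
    (f : E → EReal) (lam : ℝ) : value (moreauEnv f lam) N ≤ value f M :=
  le_iInf₂ fun x hx => (iInf₂_le x (hMN hx)).trans (moreauEnv_le f lam x)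

theorem IsOptimal.moreauEnv_le {E : Type*} [NormedAddCommGroup E] {f : E → EReal} {lam : ℝ}
    {N : Set E} {x y : E} (hx : IsOptimal (moreauEnv f lam) N x) (hy : y ∈ N) :
    moreauEnv f lam x ≤ f y :=
  (hx.2 hy).trans (ChanceConstraint.moreauEnv_le f lam y)

variable {E : Type*} [NormedAddCommGroup E] [InnerProductSpace ℝ E]

/-- The sets `N lam` approximate `M` from outside as `lam → 0⁺`: they contain `M`, and weak limits
of points of `N (lam k)` with `lam k → 0⁺` lie in `M`. This is sequential Mosco convergence of
`N lam` to `M`, restricted to outer approximations. -/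
structure IsOuterApprox (N : ℝ → Set E) (M : Set E) : Prop where
  subset : ∀ lam, 0 < lam → M ⊆ N lam
  mem_of_weaklyTendsto : ∀ (lam : ℕ → ℝ) (x : ℕ → E) (x₀ : E), (∀ k, 0 < lam k) →
    Tendsto lam atTop (𝓝 0) → (∀ k, x k ∈ N (lam k)) → WeaklyTendsto x x₀ → x₀ ∈ M

variable [CompleteSpace E] {f : E → EReal} {N : ℝ → Set E} {M : Set E}

theorem IsOuterApprox.exists_mem_le_of_moreauEnv_le (hMN : IsOuterApprox N M)
    (hf : IsConvexFun f) (hlsc : LowerSemicontinuous f) (hbot : ∀ x, f x ≠ ⊥)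
    (hcoer : IsCoercive f) {lam : ℕ → ℝ} {x : ℕ → E} {c : ℝ} (hlam : ∀ k, 0 < lam k)
    (hlim : Tendsto lam atTop (𝓝 0)) (hx : ∀ k, x k ∈ N (lam k))
    (h : ∀ k, moreauEnv f (lam k) (x k) ≤ c) : ∃ x₀ ∈ M, f x₀ ≤ c := by
  obtain ⟨a, ha⟩ := (hf.hasAffineMinorant hlsc hbot).exists_forall_le hcoer
  obtain ⟨R, hR⟩ := hcoer.exists_norm_le_of_moreauEnv_le ha hlam hlim h
  obtain ⟨x₀, φ, hφ, hx₀⟩ := exists_subseq_weaklyTendsto hR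
  have hlimφ : Tendsto (lam ∘ φ) atTop (𝓝 0) := hlim.comp hφ.tendsto_atTop
  exact ⟨x₀, hMN.mem_of_weaklyTendsto _ _ x₀ (fun k => hlam (φ k)) hlimφ (fun k => hx (φ k)) hx₀,
    hf.le_of_weaklyTendsto_of_moreauEnv_le hlsc hbot (fun k => hlam (φ k)) hlimφ hx₀
      tendsto_const_nhds fun k => h (φ k)⟩

theorem IsOuterApprox.tendsto_value_moreauEnv (hMN : IsOuterApprox N M) (hf : IsConvexFun f)
    (hlsc : LowerSemicontinuous f) (hbot : ∀ x, f x ≠ ⊥) (hcoer : IsCoercive f) :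
    Tendsto (fun lam => value (moreauEnv f lam) (N lam)) (𝓝[>] 0) (𝓝 (value f M)) := by
  refine tendsto_order.2 ⟨fun c hc => ?_, fun c hc => ?_⟩
  · by_contra hcon
    obtain ⟨c', hcc', hc'⟩ := EReal.lt_iff_exists_real_btwn.1 hc
    have hfreq : ∃ᶠ lam in 𝓝[>] (0 : ℝ), value (moreauEnv f lam) (N lam) < c' ∧ 0 < lam :=
      ((not_eventually.1 hcon).mono fun lam hlam => (not_lt.1 hlam).trans_lt hcc').and_eventually
        self_mem_nhdsWithin
    obtain ⟨lam, hlim, hlam⟩ := exists_seq_forall_of_frequently hfreq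
    have hex : ∀ k, ∃ x ∈ N (lam k), moreauEnv f (lam k) x < c' := fun k => by
      simpa [value, iInf_lt_iff] using (hlam k).1
    choose x hxN hxc using hex
    obtain ⟨x₀, hx₀, hfx₀⟩ := hMN.exists_mem_le_of_moreauEnv_le hf hlsc hbot hcoer
      (fun k => (hlam k).2) (hlim.mono_right nhdsWithin_le_nhds) hxN fun k => (hxc k).le
    exact ((iInf₂_le x₀ hx₀).trans hfx₀).not_gt hc'
  · filter_upwards [self_mem_nhdsWithin] with lam hlam
    exact (value_moreauEnv_le (hMN.subset lam hlam) f lam).trans_lt hc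

theorem IsOuterApprox.isOptimal_of_weaklyTendsto (hMN : IsOuterApprox N M) (hf : IsConvexFun f)
    (hlsc : LowerSemicontinuous f) (hbot : ∀ x, f x ≠ ⊥) {lam : ℕ → ℝ} {x : ℕ → E} {x₀ : E}
    (hlam : ∀ k, 0 < lam k) (hlim : Tendsto lam atTop (𝓝 0))
    (hopt : ∀ k, IsOptimal (moreauEnv f (lam k)) (N (lam k)) (x k)) (hx : WeaklyTendsto x x₀) :
    IsOptimal f M x₀ := by
  refine ⟨hMN.mem_of_weaklyTendsto lam x x₀ hlam hlim (fun k => (hopt k).1) hx, fun y hy => ?_⟩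
  have henv : ∀ k, moreauEnv f (lam k) (x k) ≤ f y := fun k =>
    (hopt k).moreauEnv_le (hMN.subset _ (hlam k) hy)
  change f x₀ ≤ f y
  rcases eq_or_ne (f y) ⊤ with htop | htop
  · exact htop ▸ le_top
  lift f y to ℝ using ⟨htop, hbot y⟩ with c
  exact hf.le_of_weaklyTendsto_of_moreauEnv_le hlsc hbot hlam hlim hx tendsto_const_nhds henv

theorem IsConvexFun.tendsto_of_weaklyTendsto_of_isOptimal (hf : IsConvexFun f)
    (hlsc : LowerSemicontinuous f) (hbot : ∀ x, f x ≠ ⊥) (hdom : effDom f = univ)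
    (hdiff : ∀ u, (subdiff (conjugate f) u).Nonempty → FrechetDiffAt (conjugate f) u)
    {lam : ℕ → ℝ} {x : ℕ → E} {x₀ : E} (hlam : ∀ k, 0 < lam k) (hlim : Tendsto lam atTop (𝓝 0))
    (hopt : ∀ k, IsOptimal (moreauEnv f (lam k)) (N (lam k)) (x k))
    (hx₀ : ∀ k, x₀ ∈ N (lam k)) (hx : WeaklyTendsto x x₀) : Tendsto x atTop (𝓝 x₀) := by
  have hr := (EReal.coe_toReal (hdom.ge (mem_univ x₀) : f x₀ < ⊤).ne (hbot x₀)).symm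
  obtain ⟨u, hu⟩ := hf.subdiff_nonempty hlsc hbot hdom x₀
  exact tendsto_of_weaklyTendsto_of_moreauEnv_le hr hu (hdiff u ⟨x₀, mem_subdiff_conjugate hr hu⟩)
    hlam hlim hx fun k => (hopt k).moreauEnv_le (hx₀ k)

end Optimization

section Cones

variable {Y : Type*} [NormedAddCommGroup Y] [NormedSpace ℝ Y] {C : Set (WeakDual ℝ Y)}

theorem nonempty_of_closure_genCone_eq_posDual {K : Set Y}
    (hgen : closure (genCone C) = posDual K) : C.Nonempty := by
  have hzero : (0 : WeakDual ℝ Y) ∈ posDual K := fun _ _ => le_rfl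
  obtain ⟨_, _, _, v, hv, _⟩ := closure_nonempty_iff.1 ⟨0, hgen ▸ hzero⟩
  exact ⟨v, hv⟩

theorem neg_mem_iff_forall_mem_apply_nonpos {K : ProperCone ℝ Y}
    (hgen : closure (genCone C) = posDual (K : Set Y)) (y : Y) :
    -y ∈ (K : Set Y) ↔ ∀ v ∈ C, v y ≤ 0 := by
  refine ⟨fun hy v hv => ?_, fun h => ?_⟩
  · have hvK : v ∈ posDual (K : Set Y) :=
      hgen ▸ subset_closure ⟨1, zero_le_one, v, hv, (one_smul ℝ v).symm⟩
    simpa using hvK _ hy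
  · by_contra hy
    obtain ⟨g, hgK, hgy⟩ := K.hyperplane_separation_point hy
    have hg : StrongDual.toWeakDual g ∈ closure (genCone C) := hgen ▸ fun z hz => hgK z hz
    have hclosed : IsClosed {v : WeakDual ℝ Y | v y ≤ 0} :=
      isClosed_Iic.preimage (WeakDual.eval_continuous y)
    have hsub : genCone C ⊆ {v : WeakDual ℝ Y | v y ≤ 0} := by
      rintro _ ⟨t, ht, v, hv, rfl⟩
      exact mul_nonpos_of_nonneg_of_nonpos ht (h v hv)
    have hgy_nonpos : g y ≤ 0 := closure_minimal hsub hclosed hg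
    rw [map_neg] at hgy
    linarith

end Cones

section SupremumFunction

variable {H Y : Type*} [NormedAddCommGroup Y] [NormedSpace ℝ Y] {m : ℕ}
  {Φ : H × EuclideanSpace ℝ (Fin m) → Y} {h : H → ℝ} {C : Set (WeakDual ℝ Y)}

theorem supFun_le_iff {q : WithLp 2 (H × EuclideanSpace ℝ (Fin m))} {t : ℝ} :
    supFun Φ h C q ≤ t ↔ ∀ v ∈ C, v (Φ (q.fst, q.snd)) + h q.fst ≤ t := by
  simp only [supFun, iSup₂_le_iff, EReal.coe_le_coe_iff]

theorem supFun_toLp_le_iff_neg_mem {K : ProperCone ℝ Y}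
    (hgen : closure (genCone C) = posDual (K : Set Y)) (x : H) (z : EuclideanSpace ℝ (Fin m)) :
    supFun Φ h C (WithLp.toLp 2 (x, z)) ≤ h x ↔ -Φ (x, z) ∈ (K : Set Y) := by
  rw [supFun_le_iff, neg_mem_iff_forall_mem_apply_nonpos hgen]
  simp

theorem supFun_ne_bot (hC : C.Nonempty) (q : WithLp 2 (H × EuclideanSpace ℝ (Fin m))) :
    supFun Φ h C q ≠ ⊥ := by
  obtain ⟨v, hv⟩ := hC
  exact ne_bot_of_le_ne_bot (EReal.coe_ne_bot _) (le_iSup₂ (f := fun (v : WeakDual ℝ Y)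
    (_ : v ∈ C) => ((v (Φ (q.fst, q.snd)) + h q.fst : ℝ) : EReal)) v hv)

variable [NormedAddCommGroup H]

theorem lowerSemicontinuous_supFun (hΦ : Continuous Φ) (hh : Continuous h) :
    LowerSemicontinuous (supFun Φ h C) := by
  have hpair : Continuous fun q : WithLp 2 (H × EuclideanSpace ℝ (Fin m)) => (q.fst, q.snd) :=
    WithLp.prod_continuous_ofLp 2 _ _
  refine lowerSemicontinuous_biSup fun v _ => Continuous.lowerSemicontinuous ?_
  exact continuous_coe_real_ereal.comp
    ((v.continuous.comp (hΦ.comp hpair)).add (hh.comp (continuous_fst.comp hpair)))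

variable [InnerProductSpace ℝ H]

theorem isConvexFun_supFun (hconv : ∀ v ∈ C,
    ConvexOn ℝ univ (fun q : H × EuclideanSpace ℝ (Fin m) => v (Φ q) + h q.1)) :
    IsConvexFun (supFun Φ h C) := by
  rintro ⟨q, s⟩ hq ⟨r, t⟩ hr a b ha hb hab
  refine supFun_le_iff.2 fun v hv => ?_
  calc v (Φ (a • (q.fst, q.snd) + b • (r.fst, r.snd))) + h (a • q.fst + b • r.fst)
      ≤ a • (v (Φ (q.fst, q.snd)) + h q.fst) + b • (v (Φ (r.fst, r.snd)) + h r.fst) :=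
        (hconv v hv).2 (mem_univ (q.fst, q.snd)) (mem_univ (r.fst, r.snd)) ha hb hab
    _ ≤ a • s + b • t := by
        gcongr
        exacts [supFun_le_iff.1 hq v hv, supFun_le_iff.1 hr v hv]

theorem neg_mem_of_frequently_moreauEnv_supFun_le [CompleteSpace H] {K : ProperCone ℝ Y}
    (hgen : closure (genCone C) = posDual (K : Set Y)) (hΦ : Continuous Φ)
    (hconv : ∀ v ∈ C,
      ConvexOn ℝ univ (fun q : H × EuclideanSpace ℝ (Fin m) => v (Φ q) + h q.1))
    (hh : SeqWeaklyContinuous h) {lam : ℕ → ℝ} {x : ℕ → H} {x₀ : H} (hlam : ∀ k, 0 < lam k)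
    (hlim : Tendsto lam atTop (𝓝 0)) (hx : WeaklyTendsto x x₀) {z : EuclideanSpace ℝ (Fin m)}
    (hfreq : ∃ᶠ k in atTop,
      moreauEnv (supFun Φ h C) (lam k) (WithLp.toLp 2 (x k, z)) ≤ (h (x k) : EReal)) :
    -Φ (x₀, z) ∈ (K : Set Y) := by
  obtain ⟨φ, hφ, hle⟩ := extraction_of_frequently_atTop hfreq
  refine (supFun_toLp_le_iff_neg_mem (h := h) hgen x₀ z).1 ?_
  exact (isConvexFun_supFun hconv).le_of_weaklyTendsto_of_moreauEnv_le
    (lowerSemicontinuous_supFun hΦ hh.continuous)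
    (supFun_ne_bot (nonempty_of_closure_genCone_eq_posDual hgen)) (fun k => hlam (φ k))
    (hlim.comp hφ.tendsto_atTop) ((hx.comp_tendsto hφ.tendsto_atTop).toLp z)
    ((hh x x₀ hx).comp hφ.tendsto_atTop) hle

end SupremumFunction

section FeasibleSets

variable {Ω : Type*} [MeasurableSpace Ω] {P : Measure Ω}

theorem le_measureReal_frequently_mem [IsFiniteMeasure P] {A : ℕ → Set Ω}
    (hA : ∀ k, NullMeasurableSet (A k) P) {p : ℝ} (h : ∀ k, p ≤ P.real (A k)) :
    p ≤ P.real {ω | ∃ᶠ k in atTop, ω ∈ A k} := by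
  set B : ℕ → Set Ω := fun n => ⋃ k ≥ n, A k with hB
  have hanti : Antitone B := fun i j hij =>
    biUnion_subset_biUnion_left fun k (hk : j ≤ k) => hij.trans hk
  have hlim : Tendsto (fun n => P.real (B n)) atTop (𝓝 (P.real (⋂ n, B n))) :=
    (ENNReal.tendsto_toReal (measure_ne_top P _)).comp <|
      tendsto_measure_iInter_atTop (fun n => .iUnion fun k => .iUnion fun _ => hA k) hanti
        ⟨0, measure_ne_top P _⟩
  have hset : {ω | ∃ᶠ k in atTop, ω ∈ A k} = ⋂ n, B n := by
    ext ω
    simp [hB, frequently_atTop]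
  rw [hset]
  exact ge_of_tendsto' hlim fun n =>
    (h n).trans <| measureReal_mono (fun ω hω => mem_iUnion₂.2 ⟨n, le_rfl, hω⟩)
      (measure_ne_top P _)

theorem nullMeasurableSet_moreauEnv_comp_le {E Z : Type*} [NormedAddCommGroup E]
    [TopologicalSpace Z] [MeasurableSpace Z] [OpensMeasurableSpace Z] {ξ : Ω → Z}
    (hξ : AEMeasurable ξ P) (f : E → EReal) (lam : ℝ) {g : Z → E} (hg : Continuous g) (t : EReal) :
    NullMeasurableSet {ω | moreauEnv f lam (g (ξ ω)) ≤ t} P :=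
  hξ.nullMeasurable (((upperSemicontinuous_moreauEnv f lam).comp hg).measurable measurableSet_Iic)

variable {H Y : Type*} [NormedAddCommGroup H] [NormedAddCommGroup Y] [NormedSpace ℝ Y] {m : ℕ}
  {ξ : Ω → EuclideanSpace ℝ (Fin m)} {Φ : H × EuclideanSpace ℝ (Fin m) → Y} {h : H → ℝ}
  {C : Set (WeakDual ℝ Y)} {K : ProperCone ℝ Y}

theorem feas_subset_feasReg [IsFiniteMeasure P]
    (hgen : closure (genCone C) = posDual (K : Set Y)) (p lam : ℝ) :
    feas P ξ Φ (K : Set Y) p ⊆ feasReg P ξ Φ h C p lam := fun x hx =>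
  hx.trans <| measureReal_mono fun ω hω =>
    (moreauEnv_le _ _ _).trans ((supFun_toLp_le_iff_neg_mem hgen x (ξ ω)).2 hω)

theorem isOuterApprox_feasReg [InnerProductSpace ℝ H] [CompleteSpace H] [IsFiniteMeasure P]
    (hξ : AEMeasurable ξ P) (hgen : closure (genCone C) = posDual (K : Set Y))
    (hΦ : Continuous Φ) (hconv : ∀ v ∈ C,
      ConvexOn ℝ univ (fun q : H × EuclideanSpace ℝ (Fin m) => v (Φ q) + h q.1))
    (hh : SeqWeaklyContinuous h) (p : ℝ) :
    IsOuterApprox (feasReg P ξ Φ h C p) (feas P ξ Φ (K : Set Y) p) where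
  subset lam _ := feas_subset_feasReg hgen p lam
  mem_of_weaklyTendsto lam x x₀ hlam hlim hmem hx := by
    have hnull := fun k => nullMeasurableSet_moreauEnv_comp_le hξ (supFun Φ h C) (lam k)
      ((WithLp.prod_continuous_toLp 2 H _).comp (.prodMk_right (x k))) (h (x k))
    exact (le_measureReal_frequently_mem hnull hmem).trans <| measureReal_mono fun ω hω =>
      neg_mem_of_frequently_moreauEnv_supFun_le hgen hΦ hconv hh hlam hlim hx hω

end FeasibleSets

end ChanceConstraint

open ChanceConstraint in
theorem mainTheorem5_general
    {H Y Ω : Type*}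
    [NormedAddCommGroup H] [InnerProductSpace ℝ H] [CompleteSpace H]
    [NormedAddCommGroup Y] [NormedSpace ℝ Y]
    [MeasurableSpace Ω] (P : Measure Ω) [IsFiniteMeasure P]
    {m : ℕ} (ξ : Ω → EuclideanSpace ℝ (Fin m)) (hξ : AEMeasurable ξ P)
    (K : ProperCone ℝ Y)
    (C : Set (WeakDual ℝ Y)) (hC_gen : closure (genCone C) = posDual (K : Set Y))
    (Φ : H × EuclideanSpace ℝ (Fin m) → Y) (hΦ : Continuous Φ)
    (h : H → ℝ)
    (hΦ_convex : ∀ v ∈ C,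
      ConvexOn ℝ univ (fun q : H × EuclideanSpace ℝ (Fin m) => v (Φ q) + h q.1))
    (p : ℝ)
    (ψ : H → EReal) (hψ_bot : ∀ x, ψ x ≠ ⊥) (hψ_convex : IsConvexFun ψ)
    (hψ_coercive : IsCoercive ψ) (hψ_lsc : LowerSemicontinuous ψ)
    (hfeas : (feas P ξ Φ (K : Set Y) p ∩ effDom ψ).Nonempty) :
    (∃ r : ℝ, value ψ (feas P ξ Φ (K : Set Y) p) = (r : EReal)) ∧
    (∀ lam : ℝ, 0 < lam →
      ∃ r : ℝ, value (moreauEnv ψ lam) (feasReg P ξ Φ h C p lam) = (r : EReal)) ∧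
    (SeqWeaklyContinuous h →
      Tendsto (fun lam : ℝ => value (moreauEnv ψ lam) (feasReg P ξ Φ h C p lam))
        (𝓝[>] 0) (𝓝 (value ψ (feas P ξ Φ (K : Set Y) p))) ∧
      ∀ (lam : ℕ → ℝ) (x : ℕ → H) (x₀ : H),
        (∀ k, 0 < lam k) → Tendsto lam atTop (𝓝 0) →
        (∀ k, IsOptimal (moreauEnv ψ (lam k)) (feasReg P ξ Φ h C p (lam k)) (x k)) →
        WeaklyTendsto x x₀ →
        IsOptimal ψ (feas P ξ Φ (K : Set Y) p) x₀ ∧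
        (effDom ψ = univ →
          (∀ u : H, (subdiff (conjugate ψ) u).Nonempty → FrechetDiffAt (conjugate ψ) u) →
          Tendsto x atTop (𝓝 x₀))) := by
  have hsub := feas_subset_feasReg (P := P) (ξ := ξ) (Φ := Φ) (h := h) hC_gen p
  obtain ⟨a, ha⟩ := (hψ_convex.hasAffineMinorant hψ_lsc hψ_bot).exists_forall_le hψ_coercive
  refine ⟨exists_value_eq_coe ha hfeas, fun lam hlam => ?_, fun hw => ?_⟩
  · exact exists_value_eq_coe (le_moreauEnv ha hlam) <| hfeas.mono <|
      inter_subset_inter (hsub lam) fun x hx => (moreauEnv_le ψ lam x).trans_lt hx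
  have hMN := isOuterApprox_feasReg hξ hC_gen hΦ hΦ_convex hw p
  refine ⟨hMN.tendsto_value_moreauEnv hψ_convex hψ_lsc hψ_bot hψ_coercive,
    fun lam x x₀ hlam hlim hopt hx => ?_⟩
  have hx₀ := hMN.isOptimal_of_weaklyTendsto hψ_convex hψ_lsc hψ_bot hlam hlim hopt hx
  exact ⟨hx₀, fun hdom hdiff => hψ_convex.tendsto_of_weaklyTendsto_of_isOptimal hψ_lsc hψ_bot
    hdom hdiff hlam hlim hopt (fun k => hsub (lam k) hx₀.1) hx⟩

open ChanceConstraint in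
theorem mainTheorem5
    {H Y Ω : Type*}
    [NormedAddCommGroup H] [InnerProductSpace ℝ H] [CompleteSpace H]
    [TopologicalSpace.SeparableSpace H]
    [NormedAddCommGroup Y] [NormedSpace ℝ Y] [CompleteSpace Y]
    [MeasurableSpace Ω] (P : Measure Ω) [IsProbabilityMeasure P]
    {m : ℕ} (ξ : Ω → EuclideanSpace ℝ (Fin m)) (hξ : Measurable ξ)
    (hξ_density : HasPDF ξ P volume)
    -- the closed convex cone, and a weak-* compact convex generator of its positive dual cone
    (K : ProperCone ℝ Y)
    (C : Set (WeakDual ℝ Y)) (hC_ne : C.Nonempty) (hC_compact : IsCompact C)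
    (hC_convex : Convex ℝ C) (hC_gen : closure (genCone C) = posDual (K : Set Y))
    -- the constraint function and the convexity of its scalarizations up to `h`
    (Φ : H × EuclideanSpace ℝ (Fin m) → Y) (hΦ : Continuous Φ)
    (h : H → ℝ) (hh_smooth : ContDiff ℝ 1 h) (hh_convex : ConvexOn ℝ univ h)
    (hΦ_convex : ∀ v ∈ C,
      ConvexOn ℝ univ (fun q : H × EuclideanSpace ℝ (Fin m) => v (Φ q) + h q.1))
    (p : ℝ) (hp : p ∈ Icc (0 : ℝ) 1)
    -- the objective function, with values in `ℝ ∪ {+∞}`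
    (ψ : H → EReal) (hψ_bot : ∀ x, ψ x ≠ ⊥) (hψ_convex : IsConvexFun ψ)
    (hψ_coercive : IsCoercive ψ) (hψ_lsc : LowerSemicontinuous ψ)
    (hfeas : (feas P ξ Φ (K : Set Y) p ∩ effDom ψ).Nonempty) :
    (∃ r : ℝ, value ψ (feas P ξ Φ (K : Set Y) p) = (r : EReal)) ∧
    (∀ lam : ℝ, 0 < lam →
      ∃ r : ℝ, value (moreauEnv ψ lam) (feasReg P ξ Φ h C p lam) = (r : EReal)) ∧
    (SeqWeaklyContinuous h →
      Tendsto (fun lam : ℝ => value (moreauEnv ψ lam) (feasReg P ξ Φ h C p lam))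
        (𝓝[>] 0) (𝓝 (value ψ (feas P ξ Φ (K : Set Y) p))) ∧
      ∀ (lam : ℕ → ℝ) (x : ℕ → H) (x₀ : H),
        (∀ k, 0 < lam k) → Tendsto lam atTop (𝓝 0) →
        (∀ k, IsOptimal (moreauEnv ψ (lam k)) (feasReg P ξ Φ h C p (lam k)) (x k)) →
        WeaklyTendsto x x₀ →
        IsOptimal ψ (feas P ξ Φ (K : Set Y) p) x₀ ∧
        (effDom ψ = univ →
          (∀ u : H, (subdiff (conjugate ψ) u).Nonempty → FrechetDiffAt (conjugate ψ) u) →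
          Tendsto x atTop (𝓝 x₀))) := by
  exact mainTheorem5_general P ξ hξ.aemeasurable K C hC_gen Φ hΦ h hΦ_convex p ψ hψ_bot hψ_convex
    hψ_coercive hψ_lsc hfeas
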